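/- Let $\mathbb K$ be an algebraically closed field of characteristic $p>0$, let $G$ be a connected reductive algebraic group over $\mathbb K$ with maximal torus $T$ and Borel subgroup $B\supseteq T$, let $X=X(T)$ be the character group of $T$, and put $\mathfrak g=\mathrm{Lie}(G)$, $\mathfrak h=\mathrm{Lie}(T)$, $\mathfrak b=\mathrm{Lie}(B)$. Let $R\subset X$ be the set of roots, $R^+$ the positive roots (those with $\mathfrak g_\alpha\subseteq\mathfrak b$) and $\Pi$ the simple roots. Fix a basis $\{e_\alpha,h_i\mid \alpha\in R,\ 1\le i\le d\}$ of $\mathfrak g$ with $e_\alpha\in\mathfrak g_\alpha$ and $h_1,\dots,h_d$ a basis of $\mathfrak h$ with $h_i^{[p]}=h_i$, and put $h_\alpha=[e_\alpha,e_{-\alpha}]\in\mathfrak h$. Let $I\subseteq\Pi$ and let $\chi\in\mathfrak g^*$ be in standard Levi form for $I$: $\chi(\mathfrak b)=0$ and, for $\alpha\in R^+$, $\chi(e_{-\alpha})=1$ if $\alpha\in I$ and $\chi(e_{-\alpha})=0$ otherwise. Put $U_\chi=U(\mathfrak g)/\langle e_\alpha^p-\chi(e_\alpha)^p\mid\alpha\in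 R\rangle$, graded by $X/\mathbb ZI$ with $e_\alpha$ in degree $\alpha+\mathbb ZI$ and $\mathfrak h$ in degree $0$, and $U^0=U(\mathfrak h)$. For $\mu\in X$ let $d\mu\in\mathfrak h^*$ be its differential and $\widetilde\mu:U^0\to U^0$ the algebra homomorphism with $\widetilde\mu(h)=h+d\mu(h)$ for $h\in\mathfrak h$. Let $A$ be a commutative Noetherian $\mathbb K$-algebra. For a homomorphism of $\mathbb K$-algebras $\pi:U^0\to A$, let $\mathscr C_{A,\pi}$ be the following category. Its objects are $U_\chi\otimes A$-modules $M$ (written with $U_\chi$ acting on the left and $A$ on the right) with a grading $M=\bigoplus_{\lambda+\mathbb ZI\in X/\mathbb ZI}M_{\lambda+\mathbb ZI}$ by $\mathbb K$-subspaces such that (A) $M_{\lambda+\mathbb ZI}A\subseteq M_{\lambda+\mathbb ZI}$; (B) only finitely many $M_{\lambda+\mathbb ZI}$ are nonzero and each is a finitely generated $A$-module; (C) $(U_\chi)_{\sigma+\mathbb ZI}M_{\lambda+\mathbb ZI}\subseteq M_{\sigma+\lambda+\mathbb ZI}$; (D) each $M_{\lambda+\mathbb ZI}$ has a decomposition $M_{\lambda+\mathbb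 ZI}=\bigoplus_{d\mu:\ \mu\in\lambda+\mathbb ZI+pX}M_{\lambda+\mathbb ZI}^{d\mu}$, indexed by the distinct differentials $d\mu$, such that for $m\in M_{\lambda+\mathbb ZI}^{d\mu}$ one has $sm=m\,\pi(\widetilde\mu(s))$ for all $s\in U^0$, $e_\alpha m\in M_{\lambda+\alpha+\mathbb ZI}^{d(\mu+\alpha)}$ for all $\alpha\in R$, and $ma\in M_{\lambda+\mathbb ZI}^{d\mu}$ for all $a\in A$. Morphisms $M\to N$ are the homomorphisms of $U_\chi\otimes A$-modules that send $M_{\lambda+\mathbb ZI}^{d\mu}$ to $N_{\lambda+\mathbb ZI}^{d\mu}$ for all $\lambda+\mathbb ZI$ and all $\mu\in\lambda+\mathbb ZI+pX$. Fix $\pi:U^0\to A$, write $\mathscr C_A=\mathscr C_{A,\pi}$, and let $\mathscr C_A^\circ=\mathscr C_{A,\pi^\circ}$, where $\pi^\circ:U^0\to\mathbb K\to A$ is the structure map with $\pi^\circ(h)=0$ for all $h\in\mathfrak h$. **Proposition.** If $\pi(h_\alpha)=0$ for all $\alpha\in R$, there is an equivalence of categories $\Theta_A:\mathscr C_A^\circ\to\mathscr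 C_A$ such that, for every object $M$ of $\mathscr C_A^\circ$, the object $\Theta_A(M)$ is equal to $M$ as an $A$-module, with the same grading and the same summands $M_{\lambda+\mathbb ZI}^{d\mu}$; each $e_\alpha$ ($\alpha\in R$) acts on $\Theta_A(M)$ as it does on $M$; each $s\in U^0$ acts on $m\in\Theta_A(M)_{\lambda+\mathbb ZI}^{d\mu}=M_{\lambda+\mathbb ZI}^{d\mu}$ (for $\mu\in\lambda+\mathbb ZI+pX$) by $s\cdot m=m\,\pi(\widetilde\mu(s))$; and $\Theta_A(f)=f$ as a map for every morphism $f$ of $\mathscr C_A^\circ$. -/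

import Mathlib

open CategoryTheory

universe u v w

attribute [local instance 100] LieRing.ofAssociativeRing

noncomputable section

namespace ReducedEnveloping

/-! ## Linear algebraic groups, as Zariski closed subgroups of `GL_n(K)` -/

section AlgebraicGroups

variable {n : ℕ} {K : Type u} [Field K]

/-- Polynomials in the entries of a matrix `g` (left summand) and of `g⁻¹` (right summand).
As functions on `GL_n(K)` they are exactly the regular functions. -/
abbrev Coord (n : ℕ) (K : Type u) [Field K] : Type u :=
  MvPolynomial ((Fin n × Fin n) ⊕ (Fin n × Fin n)) K

/-- The value of a regular function at `g`. -/
def evalAt (g : GL (Fin n) K) : Coord n K →ₐ[K] K :=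
  MvPolynomial.aeval (Sum.elim
    (fun a => (g : Matrix (Fin n) (Fin n) K) a.1 a.2)
    (fun a => ((g⁻¹ : GL (Fin n) K) : Matrix (Fin n) (Fin n) K) a.1 a.2))

/-- The Zariski topology on `GL_n(K)`, generated by the principal open sets. -/
@[reducible] def zariski (n : ℕ) (K : Type u) [Field K] : TopologicalSpace (GL (Fin n) K) :=
  TopologicalSpace.generateFrom {U | ∃ f : Coord n K, U = {g | evalAt g f ≠ 0}}

/-- Zariski closed subgroups of `GL_n(K)`, i.e. linear algebraic groups. -/
def IsClosedSubgroup (H : Subgroup (GL (Fin n) K)) : Prop :=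
  @IsClosed _ (zariski n K) (H : Set (GL (Fin n) K))

/-- Connectedness in the Zariski topology. -/
def IsConnectedSubgroup (H : Subgroup (GL (Fin n) K)) : Prop :=
  @IsConnected _ (zariski n K) (H : Set (GL (Fin n) K))

/-- A torus: a closed connected diagonalizable subgroup. -/
def IsTorus (H : Subgroup (GL (Fin n) K)) : Prop :=
  IsClosedSubgroup H ∧ IsConnectedSubgroup H ∧
    ∃ q : GL (Fin n) K, ∀ t ∈ H, ((q * t * q⁻¹ : GL (Fin n) K) : Matrix (Fin n) (Fin n) K).IsDiag

def IsMaximalTorus (G T : Subgroup (GL (Fin n) K)) : Prop :=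
  Maximal (fun H => H ≤ G ∧ IsTorus H) T

/-- A Borel subgroup: a maximal closed connected solvable subgroup. -/
def IsBorel (G B : Subgroup (GL (Fin n) K)) : Prop :=
  Maximal (fun H : Subgroup (GL (Fin n) K) =>
    H ≤ G ∧ IsClosedSubgroup H ∧ IsConnectedSubgroup H ∧ Group.IsSolvable H) B

/-- A connected reductive group: closed, connected, and every closed connected normal
unipotent subgroup is trivial. -/
def IsConnectedReductive (G : Subgroup (GL (Fin n) K)) : Prop :=
  IsClosedSubgroup G ∧ IsConnectedSubgroup G ∧
    ∀ N : Subgroup (GL (Fin n) K), N ≤ G → IsClosedSubgroup N → IsConnectedSubgroup N →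
      (N.subgroupOf G).Normal →
      (∀ g ∈ N, IsNilpotent ((g : Matrix (Fin n) (Fin n) K) - 1)) → N = ⊥

/-- The left invariant derivation of the ring of regular functions given by a matrix `x`; its
value at `g` is the derivative in the direction `g x`. It sends the coordinate matrix `Z` to `Z x`
and `Z⁻¹` to `- x Z⁻¹`. -/
def leftDer (x : Matrix (Fin n) (Fin n) K) : Derivation K (Coord n K) (Coord n K) :=
  MvPolynomial.mkDerivation K (Sum.elim
    (fun a => ∑ k, MvPolynomial.X (Sum.inl (a.1, k)) * MvPolynomial.C (x k a.2))
    (fun a => - ∑ k, MvPolynomial.C (x a.1 k) * MvPolynomial.X (Sum.inr (k, a.2))))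

lemma leftDer_inl (x : Matrix (Fin n) (Fin n) K) (a : Fin n × Fin n) :
    leftDer x (MvPolynomial.X (Sum.inl a)) =
      ∑ k, MvPolynomial.X (Sum.inl (a.1, k)) * MvPolynomial.C (x k a.2) := by
  simp [leftDer, MvPolynomial.mkDerivation_X]

lemma leftDer_inr (x : Matrix (Fin n) (Fin n) K) (a : Fin n × Fin n) :
    leftDer x (MvPolynomial.X (Sum.inr a)) =
      - ∑ k, MvPolynomial.C (x a.1 k) * MvPolynomial.X (Sum.inr (k, a.2)) := by
  simp [leftDer, MvPolynomial.mkDerivation_X]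

lemma leftDer_C (x : Matrix (Fin n) (Fin n) K) (c : K) :
    leftDer x (MvPolynomial.C c) = 0 := by
  simp [leftDer]

lemma leftDer_C_mul (x : Matrix (Fin n) (Fin n) K) (c : K) (f : Coord n K) :
    leftDer x (MvPolynomial.C c * f) = MvPolynomial.C c * leftDer x f := by
  simp [Derivation.leibniz]

lemma leftDer_add (x y : Matrix (Fin n) (Fin n) K) :
    leftDer (x + y) = leftDer x + leftDer y := by
  apply MvPolynomial.derivation_ext
  rintro (a | a)
  · simp [leftDer_inl, mul_add, Finset.sum_add_distrib]
  · simp [leftDer_inr, add_mul, Finset.sum_add_distrib, add_comm]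

lemma leftDer_smul (c : K) (x : Matrix (Fin n) (Fin n) K) :
    leftDer (c • x) = c • leftDer x := by
  apply MvPolynomial.derivation_ext
  rintro (a | a)
  · simp only [leftDer_inl, Derivation.smul_apply, MvPolynomial.smul_eq_C_mul, Finset.mul_sum,
      Matrix.smul_apply, smul_eq_mul, map_mul]
    exact Finset.sum_congr rfl fun k _ => by ring
  · simp only [leftDer_inr, Derivation.smul_apply, MvPolynomial.smul_eq_C_mul, Finset.mul_sum,
      Matrix.smul_apply, smul_eq_mul, map_mul, mul_neg]
    exact congrArg _ (Finset.sum_congr rfl fun k _ => by ring)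

lemma leftDer_lie (x y : Matrix (Fin n) (Fin n) K) :
    leftDer ⁅x, y⁆ = ⁅leftDer x, leftDer y⁆ := by
  apply MvPolynomial.derivation_ext
  rintro (a | a)
  · have key : ∀ x y : Matrix (Fin n) (Fin n) K,
        leftDer x (leftDer y (MvPolynomial.X (Sum.inl a))) =
        ∑ k, MvPolynomial.X (Sum.inl (a.1, k)) * MvPolynomial.C ((x * y) k a.2) := by
      intro x y
      rw [leftDer_inl, map_sum]
      simp_rw [mul_comm _ (MvPolynomial.C _), leftDer_C_mul, leftDer_inl, Finset.mul_sum]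
      rw [Finset.sum_comm]
      refine Finset.sum_congr rfl fun k _ => ?_
      rw [Matrix.mul_apply, map_sum, Finset.sum_mul]
      refine Finset.sum_congr rfl fun l _ => ?_
      simp only [map_mul]
      ring
    rw [Derivation.commutator_apply, key, key, leftDer_inl, ← Finset.sum_sub_distrib]
    refine Finset.sum_congr rfl fun k _ => ?_
    rw [Ring.lie_def, Matrix.sub_apply, map_sub, mul_sub]
  · have key : ∀ x y : Matrix (Fin n) (Fin n) K,
        leftDer x (leftDer y (MvPolynomial.X (Sum.inr a))) =
        ∑ k, MvPolynomial.C ((y * x) a.1 k) * MvPolynomial.X (Sum.inr (k, a.2)) := by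
      intro x y
      rw [leftDer_inr, map_neg, map_sum]
      simp_rw [leftDer_C_mul, leftDer_inr, mul_neg, Finset.sum_neg_distrib, neg_neg,
        Finset.mul_sum]
      rw [Finset.sum_comm]
      refine Finset.sum_congr rfl fun k _ => ?_
      rw [Matrix.mul_apply, map_sum, Finset.sum_mul]
      refine Finset.sum_congr rfl fun l _ => ?_
      simp only [map_mul]
      ring
    rw [Derivation.commutator_apply, key, key, leftDer_inr, ← Finset.sum_sub_distrib,
      ← Finset.sum_neg_distrib]
    refine Finset.sum_congr rfl fun k _ => ?_
    rw [Ring.lie_def, Matrix.sub_apply, map_sub]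
    ring

/-- Left translation of regular functions: `(leftTrans g f)(t) = f (g t)`. -/
def leftTrans (g : GL (Fin n) K) : Coord n K →ₐ[K] Coord n K :=
  MvPolynomial.aeval (Sum.elim
    (fun a => ∑ k, MvPolynomial.C ((g : Matrix (Fin n) (Fin n) K) a.1 k) *
      MvPolynomial.X (Sum.inl (k, a.2)))
    (fun a => ∑ k, MvPolynomial.C (((g⁻¹ : GL (Fin n) K) : Matrix (Fin n) (Fin n) K) k a.2) *
      MvPolynomial.X (Sum.inr (a.1, k))))

lemma evalAt_leftTrans (g t : GL (Fin n) K) (f : Coord n K) :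
    evalAt t (leftTrans g f) = evalAt (g * t) f := by
  have : (evalAt t).comp (leftTrans g) = evalAt (g * t) := by
    apply MvPolynomial.algHom_ext
    rintro (a | a)
    · simp [evalAt, leftTrans, Matrix.mul_apply]
    · simp only [evalAt, leftTrans, AlgHom.comp_apply, MvPolynomial.aeval_X, Sum.elim_inr, map_sum,
        map_mul, MvPolynomial.algHom_C, mul_inv_rev, Units.val_mul, Matrix.mul_apply]
      exact Finset.sum_congr rfl fun k _ => mul_comm _ _
  exact congrArg (fun φ : Coord n K →ₐ[K] K => φ f) this

lemma leftDer_leftTrans (x : Matrix (Fin n) (Fin n) K) (g : GL (Fin n) K) (f : Coord n K) :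
    leftDer x (leftTrans g f) = leftTrans g (leftDer x f) := by
  induction f using MvPolynomial.induction_on with
  | C c => simp [leftTrans]
  | add f₁ f₂ h₁ h₂ => simp [h₁, h₂]
  | mul_X f a h =>
    have hX : leftDer x (leftTrans g (MvPolynomial.X a)) =
        leftTrans g (leftDer x (MvPolynomial.X a)) := by
      rcases a with a | a
      · rw [leftDer_inl]
        simp only [leftTrans, MvPolynomial.aeval_X, Sum.elim_inl, map_sum, leftDer_C_mul,
          leftDer_inl, map_mul, MvPolynomial.algHom_C, Finset.mul_sum, Finset.sum_mul]
        rw [Finset.sum_comm]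
        exact Finset.sum_congr rfl fun k _ => Finset.sum_congr rfl fun l _ => by
          simp only [MvPolynomial.algebraMap_eq]; ring
      · rw [leftDer_inr]
        simp only [leftTrans, MvPolynomial.aeval_X, Sum.elim_inr, map_sum, leftDer_C_mul, map_neg,
          leftDer_inr, map_mul, MvPolynomial.algHom_C, Finset.mul_sum, mul_neg,
          Finset.sum_neg_distrib]
        rw [Finset.sum_comm]
        exact congrArg _ (Finset.sum_congr rfl fun k _ => Finset.sum_congr rfl fun l _ => by
          simp only [MvPolynomial.algebraMap_eq]; ring)
    rw [map_mul, Derivation.leibniz, Derivation.leibniz, hX, h]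
    simp [map_add, map_mul]

/-- `x` is tangent to `H` at the identity: the derivative at `1` in the direction `x` of every
regular function that vanishes on `H` is zero. -/
def IsTangent (H : Subgroup (GL (Fin n) K)) (x : Matrix (Fin n) (Fin n) K) : Prop :=
  ∀ f : Coord n K, (∀ g ∈ H, evalAt g f = 0) → evalAt 1 (leftDer x f) = 0

lemma IsTangent.vanish {H : Subgroup (GL (Fin n) K)} {x : Matrix (Fin n) (Fin n) K}
    (hx : IsTangent H x) {f : Coord n K} (hf : ∀ g ∈ H, evalAt g f = 0) :
    ∀ g ∈ H, evalAt g (leftDer x f) = 0 := by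
  intro g hg
  have := hx (leftTrans g f) fun t ht => by
    rw [evalAt_leftTrans]; exact hf _ (H.mul_mem hg ht)
  rwa [leftDer_leftTrans, evalAt_leftTrans, mul_one] at this

/-- The Lie algebra of `H`: its tangent space at the identity, inside `gl_n(K)` with the commutator
bracket. Its `p`-th power map, in characteristic `p`, is the `p`-th power of matrices. -/
def lieAlg (H : Subgroup (GL (Fin n) K)) : LieSubalgebra K (Matrix (Fin n) (Fin n) K) where
  carrier := {x | IsTangent H x}
  add_mem' := fun {x y} hx hy f hf => by
    rw [leftDer_add, Derivation.add_apply, map_add, hx f hf, hy f hf, add_zero]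
  zero_mem' := fun f _ => by
    have : leftDer (0 : Matrix (Fin n) (Fin n) K) = 0 := by
      simpa using leftDer_smul (0 : K) (0 : Matrix (Fin n) (Fin n) K)
    simp [this]
  smul_mem' := fun c x hx f hf => by
    rw [leftDer_smul, Derivation.smul_apply, map_smul, hx f hf, smul_zero]
  lie_mem' := fun {x y} hx hy f hf => by
    rw [leftDer_lie, Derivation.commutator_apply, map_sub,
      hx _ (IsTangent.vanish hy hf), hy _ (IsTangent.vanish hx hf), sub_zero]

lemma lieAlg_mono {H H' : Subgroup (GL (Fin n) K)} (h : H ≤ H') : lieAlg H ≤ lieAlg H' :=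
  fun _ hx f hf => hx f fun g hg => hf g (h hg)

/-- A homomorphism `H → Kˣ` is regular if it is the restriction of a regular function. -/
def IsRegularChar (H : Subgroup (GL (Fin n) K)) (c : H →* Kˣ) : Prop :=
  ∃ f : Coord n K, ∀ t : H, ((c t : Kˣ) : K) = evalAt (t : GL (Fin n) K) f

/-- The characters of `H`, as a multiplicative group. -/
def characters (H : Subgroup (GL (Fin n) K)) : Subgroup (H →* Kˣ) where
  carrier := {c | IsRegularChar H c}
  mul_mem' := by
    rintro c c' ⟨f, hf⟩ ⟨f', hf'⟩
    exact ⟨f * f', fun t => by simp [hf, hf']⟩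
  one_mem' := ⟨1, fun t => by simp⟩
  inv_mem' := by
    rintro c ⟨f, hf⟩
    refine ⟨MvPolynomial.rename Sum.swap f, fun t => ?_⟩
    have h1 : (((c⁻¹ : H →* Kˣ) t : Kˣ) : K) = ((c t⁻¹ : Kˣ) : K) := by simp
    rw [h1, hf, evalAt, evalAt, MvPolynomial.aeval_rename]
    congr 1
    congr 1
    funext a
    rcases a with a | a <;> simp

/-- The character group `X(H)`, written additively. -/
abbrev CharLattice (H : Subgroup (GL (Fin n) K)) : Type u := Additive (characters H)

/-- The value `μ(t)` of a character `μ ∈ X(H)`. -/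
def charVal {H : Subgroup (GL (Fin n) K)} (μ : CharLattice H) (t : H) : K :=
  (((Additive.toMul μ : characters H) : H →* Kˣ) t : Kˣ)

lemma exists_regular {H : Subgroup (GL (Fin n) K)} (μ : CharLattice H) :
    ∃ f : Coord n K, ∀ t : H, charVal μ t = evalAt (t : GL (Fin n) K) f :=
  (Additive.toMul μ : characters H).2

lemma charVal_mul {H : Subgroup (GL (Fin n) K)} (μ : CharLattice H) (s t : H) :
    charVal μ (s * t) = charVal μ s * charVal μ t := by
  simp [charVal]

lemma charVal_one {H : Subgroup (GL (Fin n) K)} (μ : CharLattice H) : charVal μ 1 = 1 := by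
  simp [charVal]

/-- The differential `dμ : Lie(H) → K` of a character at the identity: the derivative at `1` of any
regular function that restricts to `μ`. -/
def dchar {H : Subgroup (GL (Fin n) K)} (μ : CharLattice H) : lieAlg H →ₗ[K] K where
  toFun x := evalAt 1 (leftDer (x : Matrix (Fin n) (Fin n) K) (exists_regular μ).choose)
  map_add' x y := by simp [leftDer_add]
  map_smul' c x := by simp [leftDer_smul]

/-- The differential does not depend on the chosen regular function. -/
lemma dchar_eq {H : Subgroup (GL (Fin n) K)} (μ : CharLattice H) (f : Coord n K)
    (hf : ∀ t : H, charVal μ t = evalAt (t : GL (Fin n) K) f) (x : lieAlg H) :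
    dchar μ x = evalAt 1 (leftDer (x : Matrix (Fin n) (Fin n) K) f) := by
  have h := x.2 ((exists_regular μ).choose - f) fun g hg => by
    rw [map_sub, ← (exists_regular μ).choose_spec ⟨g, hg⟩, ← hf ⟨g, hg⟩, sub_self]
  rw [map_sub, map_sub, sub_eq_zero] at h
  exact h

lemma dchar_lie {H : Subgroup (GL (Fin n) K)} (μ : CharLattice H) (x y : lieAlg H) :
    dchar μ ⁅x, y⁆ = 0 := by
  obtain ⟨f, hf⟩ := exists_regular μ
  have h1 : ∀ z : lieAlg H, ∀ g ∈ H,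
      evalAt g (leftDer (z : Matrix (Fin n) (Fin n) K) f - MvPolynomial.C (dchar μ z) * f) = 0 := by
    intro z g hg
    have h := z.2 (leftTrans g f - MvPolynomial.C (charVal μ ⟨g, hg⟩) * f) fun t ht => by
      have h2 := hf (⟨g, hg⟩ * ⟨t, ht⟩)
      rw [charVal_mul] at h2
      rw [map_sub, evalAt_leftTrans, map_mul, MvPolynomial.algHom_C, ← hf ⟨t, ht⟩]
      simpa [sub_eq_zero] using h2.symm
    rw [map_sub, leftDer_leftTrans, leftDer_C_mul, map_sub, evalAt_leftTrans, mul_one, map_mul,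
      MvPolynomial.algHom_C, ← dchar_eq μ f hf z] at h
    rw [map_sub, map_mul, MvPolynomial.algHom_C, ← hf ⟨g, hg⟩]
    simp only [Algebra.algebraMap_self, RingHom.id_apply] at h ⊢
    rw [mul_comm]
    exact h
  have h3 : ∀ z w : lieAlg H, evalAt 1 (leftDer (w : Matrix (Fin n) (Fin n) K)
      (leftDer (z : Matrix (Fin n) (Fin n) K) f)) = dchar μ z * dchar μ w := by
    intro z w
    have h := w.2 _ (h1 z)
    rw [map_sub, leftDer_C_mul, map_sub, map_mul, MvPolynomial.algHom_C, ← dchar_eq μ f hf w,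
      sub_eq_zero] at h
    simpa using h
  rw [dchar_eq μ f hf, LieSubalgebra.coe_bracket, leftDer_lie, Derivation.commutator_apply,
    map_sub, h3, h3]
  ring

/-- The root space `𝔤_α` for the adjoint action (conjugation) of `T` on `𝔤 = Lie(G)`. -/
def rootSpace (G T : Subgroup (GL (Fin n) K)) (α : CharLattice T) : Submodule K (lieAlg G) where
  carrier := {x | ∀ t : T, ((t : GL (Fin n) K) : Matrix (Fin n) (Fin n) K) * x.1 *
    (((t : GL (Fin n) K)⁻¹ : GL (Fin n) K) : Matrix (Fin n) (Fin n) K) = charVal α t • x.1}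
  add_mem' := fun {x y} hx hy t => by
    have := congrArg₂ (· + ·) (hx t) (hy t)
    simpa [mul_add, add_mul] using this
  zero_mem' := fun t => by simp
  smul_mem' := fun c x hx t => by
    have := congrArg (c • ·) (hx t)
    simpa [smul_comm c] using this

/-- The roots: the nonzero weights of `T` on `𝔤`. -/
def roots (G T : Subgroup (GL (Fin n) K)) : Set (CharLattice T) :=
  {α | α ≠ 0 ∧ rootSpace G T α ≠ ⊥}

/-- The positive roots with respect to `B`: those whose root space lies in `Lie(B)`. -/
def posRoots (G T B : Subgroup (GL (Fin n) K)) : Set (CharLattice T) :=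
  {α | α ∈ roots G T ∧ ∀ x ∈ rootSpace G T α, (x : Matrix (Fin n) (Fin n) K) ∈ lieAlg B}

/-- The simple roots: the positive roots that are not a sum of two positive roots. -/
def simpleRoots (G T B : Subgroup (GL (Fin n) K)) : Set (CharLattice T) :=
  {α | α ∈ posRoots G T B ∧ ∀ β ∈ posRoots G T B, ∀ γ ∈ posRoots G T B, α ≠ β + γ}

end AlgebraicGroups

/-! ## The fixed data -/

/-- A connected reductive group `G` with maximal torus `T` and Borel subgroup `B ⊇ T`, a basis
`{e_α, h_i}` of its Lie algebra, and a linear form `χ` in standard Levi form for a set `I` of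
simple roots. -/
structure LeviDatum (K : Type u) [Field K] (p : ℕ) where
  n : ℕ
  G : Subgroup (GL (Fin n) K)
  T : Subgroup (GL (Fin n) K)
  B : Subgroup (GL (Fin n) K)
  reductive : IsConnectedReductive G
  maxTorus : IsMaximalTorus G T
  borel : IsBorel G B
  T_le_B : T ≤ B
  /-- the root vectors -/
  e : roots G T → lieAlg G
  e_mem : ∀ α : roots G T, e α ∈ rootSpace G T α
  /-- the rank of `T` -/
  d : ℕ
  /-- the basis `h_1, …, h_d` of `Lie(T)` -/
  hb : Module.Basis (Fin d) K (lieAlg T)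
  /-- `h_i^[p] = h_i` -/
  hb_pow : ∀ i, (hb i : Matrix (Fin n) (Fin n) K) ^ p = (hb i : Matrix (Fin n) (Fin n) K)
  /-- the `e_α` together with the `h_i` form a basis of `𝔤` -/
  basis_linearIndependent : LinearIndependent K
    (Sum.elim e fun i => LieSubalgebra.inclusion (lieAlg_mono maxTorus.prop.1) (hb i))
  basis_span : Submodule.span K (Set.range
    (Sum.elim e fun i => LieSubalgebra.inclusion (lieAlg_mono maxTorus.prop.1) (hb i))) = ⊤
  I : Set (CharLattice T)
  I_subset : I ⊆ simpleRoots G T B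
  χ : Module.Dual K (lieAlg G)
  χ_borel : ∀ x : lieAlg G, (x : Matrix (Fin n) (Fin n) K) ∈ lieAlg B → χ x = 0
  χ_mem : ∀ α ∈ posRoots G T B, ∀ β : roots G T, (β : CharLattice T) = -α → α ∈ I → χ (e β) = 1
  χ_notMem : ∀ α ∈ posRoots G T B, ∀ β : roots G T, (β : CharLattice T) = -α → α ∉ I → χ (e β) = 0

namespace LeviDatum

variable {K : Type u} [Field K] {p : ℕ} (D : LeviDatum K p)

/-- `𝔤 = Lie(G)` -/
abbrev g : LieSubalgebra K (Matrix (Fin D.n) (Fin D.n) K) := lieAlg D.G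

/-- `𝔥 = Lie(T)` -/
abbrev h : LieSubalgebra K (Matrix (Fin D.n) (Fin D.n) K) := lieAlg D.T

/-- The inclusion `𝔥 → 𝔤`. -/
def incl : D.h →ₗ⁅K⁆ D.g := LieSubalgebra.inclusion (lieAlg_mono D.maxTorus.prop.1)

/-- The character group `X = X(T)`. -/
abbrev X : Type u := CharLattice D.T

/-- The set of roots `R`. -/
abbrev R : Type u := roots D.G D.T

/-- `X/ℤI` -/
abbrev XI : Type u := D.X ⧸ AddSubgroup.closure D.I

/-- The coset `μ + ℤI`. -/
abbrev coset (μ : D.X) : D.XI := QuotientAddGroup.mk μ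

/-- `μ ∈ lam + pX`, where `lam` is a coset of `ℤI` in `X`. -/
def Admissible (lam : D.XI) (μ : D.X) : Prop := ∃ τ : D.X, D.coset (μ - p • τ) = lam

/-- The relations `e_α ^ p = χ(e_α) ^ p`. -/
inductive URel : UniversalEnvelopingAlgebra K D.g → UniversalEnvelopingAlgebra K D.g → Prop
  | of (α : D.R) : URel (UniversalEnvelopingAlgebra.ι K (D.e α) ^ p)
      (algebraMap K (UniversalEnvelopingAlgebra K D.g) (D.χ (D.e α) ^ p))

/-- The algebra `U_χ = U(𝔤) / ⟨e_α ^ p - χ(e_α) ^ p⟩`. -/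
abbrev Uχ : Type u := RingQuot D.URel

/-- The algebra `U⁰ = U(𝔥)`. -/
abbrev U0 : Type u := UniversalEnvelopingAlgebra K D.h

/-- The canonical map `𝔤 → U_χ`. -/
def gToU (x : D.g) : D.Uχ := RingQuot.mkAlgHom K D.URel (UniversalEnvelopingAlgebra.ι K x)

/-- The canonical map `U⁰ → U_χ`. -/
def U0toU : D.U0 →ₐ[K] D.Uχ :=
  (RingQuot.mkAlgHom K D.URel).comp
    (UniversalEnvelopingAlgebra.lift K ((UniversalEnvelopingAlgebra.ι K).comp D.incl))

/-- The generators `e_α` and `h ∈ 𝔥` of `U_χ`. -/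
def gen : D.R ⊕ D.h → D.Uχ := Sum.elim (fun α => D.gToU (D.e α)) (fun s => D.gToU (D.incl s))

/-- Their degrees: `e_α` has degree `α + ℤI` and `h ∈ 𝔥` has degree `0`. -/
def genDeg : D.R ⊕ D.h → D.XI := Sum.elim (fun α => D.coset α) (fun _ => 0)

/-- The homogeneous part `(U_χ)_σ`: the span of the monomials of degree `σ` in the generators. -/
def UGr (σ : D.XI) : Submodule K D.Uχ :=
  Submodule.span K {a | ∃ l : List (D.R ⊕ D.h), (l.map D.genDeg).sum = σ ∧ a = (l.map D.gen).prod}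

/-- The Lie algebra map `𝔥 → U⁰`, `h ↦ h + dμ(h)`. -/
def shiftLie (μ : D.X) : D.h →ₗ⁅K⁆ D.U0 :=
  { (UniversalEnvelopingAlgebra.ι K : D.h →ₗ⁅K⁆ D.U0).toLinearMap +
      (Algebra.linearMap K D.U0).comp (dchar μ) with
    map_lie' := by
      intro x y
      have h1 : ∀ (a b : D.U0) (c c' : K),
          ⁅a + algebraMap K D.U0 c, b + algebraMap K D.U0 c'⁆ = ⁅a, b⁆ := by
        intro a b c c'
        simp only [Ring.lie_def, add_mul, mul_add, Algebra.commutes c b, Algebra.commutes c' a,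
          Algebra.commutes c' (algebraMap K D.U0 c)]
        abel
      simp [dchar_lie, h1] }

/-- The algebra endomorphism `μ̃` of `U⁰` with `μ̃(h) = h + dμ(h)` for `h ∈ 𝔥`. -/
def shift (μ : D.X) : D.U0 →ₐ[K] D.U0 := UniversalEnvelopingAlgebra.lift K (D.shiftLie μ)

end LeviDatum

/-! ## The category `𝒞_A` -/

section Category

variable {K : Type u} [Field K] {p : ℕ} (D : LeviDatum K p) (A : Type v) [CommRing A] [Algebra K A]

/-- An `A`-module with an `X/ℤI`-grading by `A`-submodules, finitely many of which are nonzero and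
all of which are finitely generated, and with a decomposition of each homogeneous part
`M_lam = ⨁ M_lam^{dμ}` into `A`-submodules, indexed by the differentials `dμ ∈ 𝔥^*` of the
`μ ∈ lam + pX`. Here `M_lam^ξ` is written `wt lam ξ`, with the convention that it is zero if `ξ` is
not of the form `dμ` with `μ ∈ lam + pX`. -/
structure GrMod where
  carrier : Type w
  [addCommGroup : AddCommGroup carrier]
  [moduleK : Module K carrier]
  [module : Module A carrier]
  [isScalarTower : IsScalarTower K A carrier]
  gr : D.XI → Submodule A carrier
  gr_indep : iSupIndep gr
  gr_top : ⨆ lam, gr lam = ⊤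
  gr_finite : {lam | gr lam ≠ ⊥}.Finite
  gr_fg : ∀ lam, (gr lam).FG
  wt : D.XI → Module.Dual K D.h → Submodule A carrier
  wt_bot : ∀ lam ξ, (¬ ∃ μ, D.Admissible lam μ ∧ dchar μ = ξ) → wt lam ξ = ⊥
  wt_indep : ∀ lam, iSupIndep (wt lam)
  wt_sup : ∀ lam, ⨆ ξ, wt lam ξ = gr lam

attribute [instance] GrMod.addCommGroup GrMod.moduleK GrMod.module GrMod.isScalarTower

variable {D A}

/-- Homomorphisms of `A`-modules which send `M_lam^{dμ}` to `N_lam^{dμ}`. -/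
@[ext]
structure GrMod.Hom (M N : GrMod.{u, v, w} D A) where
  toLin : M.carrier →ₗ[A] N.carrier
  map_wt : ∀ lam ξ, ∀ m ∈ M.wt lam ξ, toLin m ∈ N.wt lam ξ

instance : Category (GrMod.{u, v, w} D A) where
  Hom M N := GrMod.Hom M N
  id M := ⟨LinearMap.id, fun _ _ _ hm => hm⟩
  comp f g := ⟨g.toLin.comp f.toLin, fun lam ξ m hm => g.map_wt lam ξ _ (f.map_wt lam ξ m hm)⟩

/-- The conditions relating an action of `U_χ` on a graded `A`-module, the grading and the structure
map `π : U⁰ → A`. -/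
structure IsAction (π : D.U0 →ₐ[K] A) (M : GrMod.{u, v, w} D A)
    (ρ : D.Uχ →ₐ[K] Module.End A M.carrier) : Prop where
  /-- `(U_χ)_σ M_lam ⊆ M_{σ + lam}` -/
  graded : ∀ σ lam, ∀ a ∈ D.UGr σ, ∀ m ∈ M.gr lam, ρ a m ∈ M.gr (σ + lam)
  /-- `s m = m π(μ̃(s))` for `m ∈ M_lam^{dμ}` -/
  weight : ∀ lam μ, D.Admissible lam μ → ∀ s : D.U0, ∀ m ∈ M.wt lam (dchar μ),
    ρ (D.U0toU s) m = π (D.shift μ s) • m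
  /-- `e_α M_lam^{dμ} ⊆ M_{lam + α}^{d(μ + α)}` -/
  root : ∀ (α : D.R) (lam) (μ), D.Admissible lam μ → ∀ m ∈ M.wt lam (dchar μ),
    ρ (D.gToU (D.e α)) m ∈ M.wt (lam + D.coset α) (dchar (μ + (α : D.X)))

variable (D A)

/-- The objects of `𝒞_A`, for the structure map `π`. A `U_χ ⊗ A`-module is given as an `A`-module
`M` with a homomorphism of `K`-algebras `U_χ → End_A(M)`. -/
structure CObj (π : D.U0 →ₐ[K] A) where
  base : GrMod.{u, v, w} D A
  ρ : D.Uχ →ₐ[K] Module.End A base.carrier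
  isAction : IsAction π base ρ

variable {D A}

/-- The morphisms of `𝒞_A`: the homomorphisms of `U_χ ⊗ A`-modules which send `M_lam^{dμ}` to
`N_lam^{dμ}`. -/
@[ext]
structure CObj.Hom {π : D.U0 →ₐ[K] A} (M N : CObj.{u, v, w} D A π) where
  toHom : M.base ⟶ N.base
  map_act : ∀ (a : D.Uχ) (m : M.base.carrier), toHom.toLin (M.ρ a m) = N.ρ a (toHom.toLin m)

/-- The category `𝒞_A`. -/
instance (π : D.U0 →ₐ[K] A) : Category (CObj.{u, v, w} D A π) where
  Hom M N := CObj.Hom M N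
  id M := ⟨𝟙 M.base, fun _ _ => rfl⟩
  comp f g := ⟨f.toHom ≫ g.toHom, fun a m =>
    (congrArg g.toHom.toLin (f.map_act a m)).trans (g.map_act a (f.toHom.toLin m))⟩

/-- The functor that forgets the action of `U_χ` and keeps the `A`-module, the grading and the
summands `M_lam^{dμ}`. -/
def forgetAction (π : D.U0 →ₐ[K] A) : CObj.{u, v, w} D A π ⥤ GrMod.{u, v, w} D A where
  obj M := M.base
  map f := f.toHom

variable (D A)

/-- The structure map `π° : U⁰ → K → A` which sends every `h ∈ 𝔥` to zero. -/
def piZero : D.U0 →ₐ[K] A :=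
  (Algebra.ofId K A).comp (UniversalEnvelopingAlgebra.lift K (0 : D.h →ₗ⁅K⁆ K))

end Category

end ReducedEnveloping

end

noncomputable section

namespace ReducedEnveloping

/-! ### Weights of a torus on the Lie algebra -/

section Weights

variable {n : ℕ} {K : Type u} [Field K]

/-! The relations of `U_χ` constrain only the `p`-th powers of root vectors and say nothing about
those of elements of `𝔥`. The action of `𝔥` may therefore be moved by scalars from `A`, as long as
the Lie bracket is respected. Let `φ : 𝔤 → A` be zero on every `e_α` and equal to `π` on `𝔥`. If `φ`
kills all brackets, then `x ↦ ρ(x) + φ(x)` is again a representation of `𝔤`, because scalars from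
`A` are central in `End_A(M)`. It satisfies the relations `e_α ^ p = χ(e_α) ^ p`, because the `e_α`
act as before. On `M_lam^{dμ}` an element `h ∈ 𝔥` then acts by `dμ(h) + π(h)` instead of `dμ(h)`, so
an object for `π°` becomes one for `π`. Subtracting `φ` undoes this, and morphisms are the same maps
on both sides.

The content is thus that `φ` kills brackets (`isTwist_twist`). Both arguments may be taken in the
basis of `T`-weight vectors. If the weights do not sum to zero, the bracket has no component in `𝔥`
(`repr_eq_zero`), so `φ` kills it. If they do, either both vectors lie in `𝔥`, where commutativity
of `A` suffices, or they are `e_α` and `e_{-α}`, whose bracket is `h_α`. It lies in `𝔥` by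
`exists_incl_eq`, and `π(h_α) = 0` by hypothesis. -/

lemma mem_rootSpace_iff {G T : Subgroup (GL (Fin n) K)} {α : CharLattice T} {x : lieAlg G} :
    x ∈ rootSpace G T α ↔ ∀ t : T, ((t : GL (Fin n) K) : Matrix (Fin n) (Fin n) K) * x.1 *
      (((t : GL (Fin n) K)⁻¹ : GL (Fin n) K) : Matrix (Fin n) (Fin n) K) = charVal α t • x.1 :=
  Iff.rfl

lemma charVal_add {H : Subgroup (GL (Fin n) K)} (μ ν : CharLattice H) (t : H) :
    charVal (μ + ν) t = charVal μ t * charVal ν t := by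
  simp [charVal]

lemma charVal_zero {H : Subgroup (GL (Fin n) K)} (t : H) :
    charVal (0 : CharLattice H) t = 1 := by
  simp [charVal]

lemma charVal_injective {H : Subgroup (GL (Fin n) K)} {μ ν : CharLattice H}
    (h : ∀ t, charVal μ t = charVal ν t) : μ = ν := by
  apply Additive.toMul.injective
  apply Subtype.ext
  ext t
  exact h t

/-- Conjugation by `t` is multiplicative, so it respects commutators and the two eigenvalues
multiply. -/
lemma lie_mem_rootSpace {G T : Subgroup (GL (Fin n) K)} {α β : CharLattice T} {x y : lieAlg G}
    (hx : x ∈ rootSpace G T α) (hy : y ∈ rootSpace G T β) : ⁅x, y⁆ ∈ rootSpace G T (α + β) := by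
  rw [mem_rootSpace_iff] at *
  intro t
  have hconj : ∀ a b : Matrix (Fin n) (Fin n) K,
      ((t : GL (Fin n) K) : Matrix (Fin n) (Fin n) K) * (a * b) *
        (((t : GL (Fin n) K)⁻¹ : GL (Fin n) K) : Matrix (Fin n) (Fin n) K) =
      (((t : GL (Fin n) K) : Matrix (Fin n) (Fin n) K) * a *
        (((t : GL (Fin n) K)⁻¹ : GL (Fin n) K) : Matrix (Fin n) (Fin n) K)) *
      (((t : GL (Fin n) K) : Matrix (Fin n) (Fin n) K) * b *
        (((t : GL (Fin n) K)⁻¹ : GL (Fin n) K) : Matrix (Fin n) (Fin n) K)) := by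
    intro a b
    simp only [mul_assoc, Units.inv_mul_cancel_left]
  rw [LieSubalgebra.coe_bracket, Ring.lie_def, mul_sub, sub_mul, hconj, hconj, hx t, hy t,
    charVal_add, smul_mul_smul_comm, smul_mul_smul_comm, mul_comm (charVal β t), smul_sub]

lemma IsTorus.commute {T : Subgroup (GL (Fin n) K)} (hT : IsTorus T) {s t : GL (Fin n) K}
    (hs : s ∈ T) (ht : t ∈ T) : s * t = t * s := by
  obtain ⟨-, -, q, hq⟩ := hT
  have h : (q * s * q⁻¹) * (q * t * q⁻¹) = (q * t * q⁻¹) * (q * s * q⁻¹) := by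
    apply Units.ext
    rw [Units.val_mul (q * s * q⁻¹), Units.val_mul (q * t * q⁻¹), ← (hq s hs).diagonal_diag, ← (hq t ht).diagonal_diag,
      Matrix.diagonal_mul_diagonal, Matrix.diagonal_mul_diagonal]
    simp only [mul_comm]
  rw [← MulAut.conj_apply, ← MulAut.conj_apply, ← map_mul, ← map_mul] at h
  exact (MulAut.conj q).injective h

/-- The Lie algebra of `T` commutes with the matrices that commute with `T`. -/
lemma lieAlg_commute {T : Subgroup (GL (Fin n) K)} {a x : Matrix (Fin n) (Fin n) K}
    (ha : ∀ s ∈ T, a * (s : Matrix (Fin n) (Fin n) K) = (s : Matrix (Fin n) (Fin n) K) * a)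
    (hx : x ∈ lieAlg T) : a * x = x * a := by
  ext i j
  -- The test function is `g ↦ (a g - g a)_{ij}`. It vanishes on `T`, and its derivative at `1` in
  -- the direction `x` is `(a x - x a)_{ij}`.
  have h := hx (∑ k, MvPolynomial.C (a i k) * MvPolynomial.X (Sum.inl (k, j)) -
    ∑ k, MvPolynomial.C (a k j) * MvPolynomial.X (Sum.inl (i, k))) fun s hs => by
      have := congrFun (congrFun (ha s hs) i) j
      simp only [Matrix.mul_apply] at this
      simp [evalAt, this, mul_comm]
  simp only [map_sub, map_sum, leftDer_C_mul, leftDer_inl] at h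
  simpa [evalAt, Matrix.one_apply, Matrix.mul_apply, sub_eq_zero, mul_comm] using h

end Weights

/-- The universal enveloping algebra of `L` is generated by `L`. -/
lemma adjoin_range_ι {R L : Type*} [CommRing R] [LieRing L] [LieAlgebra R L] :
    Algebra.adjoin R (Set.range (UniversalEnvelopingAlgebra.ι R :
      L → UniversalEnvelopingAlgebra R L)) = ⊤ := by
  set S := Algebra.adjoin R (Set.range (UniversalEnvelopingAlgebra.ι R :
    L → UniversalEnvelopingAlgebra R L))
  let f : L →ₗ⁅R⁆ S :=
    { toFun x := ⟨UniversalEnvelopingAlgebra.ι R x, Algebra.subset_adjoin ⟨x, rfl⟩⟩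
      map_add' x y := Subtype.ext (by simp)
      map_smul' c x := Subtype.ext (by simp)
      map_lie' {x y} := Subtype.ext (by simp [Ring.lie_def]) }
  -- By the universal property the identity factors through the subalgebra generated by `L`, which
  -- is therefore everything.
  have h : S.val.comp (UniversalEnvelopingAlgebra.lift R f) = AlgHom.id R _ := by
    apply UniversalEnvelopingAlgebra.hom_ext
    ext x
    simp [f]
  rw [eq_top_iff]
  rintro a -
  rw [← AlgHom.id_apply (R := R) a, ← h]
  exact Subtype.property _

/-! ### The weight basis of `𝔤` and the centralizer of `T` -/

namespace LeviDatum

variable {K : Type u} [Field K] {p : ℕ} (D : LeviDatum K p)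

/-- Since `T` is commutative, each of its elements commutes with `Lie(T)`, so conjugation fixes `𝔥`
pointwise. -/
lemma incl_mem_rootSpace (x : D.h) : D.incl x ∈ rootSpace D.G D.T 0 := by
  rw [mem_rootSpace_iff]
  intro t
  have h := lieAlg_commute (fun s hs => congrArg Units.val
    (D.maxTorus.prop.2.commute t.2 hs)) x.2
  rw [charVal_zero, one_smul]
  change _ * (x : Matrix (Fin D.n) (Fin D.n) K) * _ = (x : Matrix (Fin D.n) (Fin D.n) K)
  rw [h, mul_assoc, Units.mul_inv, mul_one]

/-- The basis `{e_α, h_i}` of `𝔤`. -/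
def basis : Module.Basis (D.R ⊕ Fin D.d) K D.g :=
  Module.Basis.mk D.basis_linearIndependent D.basis_span.ge

lemma basis_inl (α : D.R) : D.basis (Sum.inl α) = D.e α := by
  simp [basis]

lemma basis_inr (i : Fin D.d) : D.basis (Sum.inr i) = D.incl (D.hb i) := by
  simp [basis, incl]

/-- The weights of the elements of the basis. -/
def basisWeight : D.R ⊕ Fin D.d → D.X := Sum.elim (fun α => α) fun _ => 0

lemma basis_mem_rootSpace (b : D.R ⊕ Fin D.d) :
    D.basis b ∈ rootSpace D.G D.T (D.basisWeight b) := by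
  rcases b with α | i
  · rw [basis_inl]; exact D.e_mem α
  · rw [basis_inr]; exact D.incl_mem_rootSpace _

/-- An element of weight `γ` is a combination of elements of the basis of weight `γ`. -/
lemma repr_eq_zero {γ : D.X} {x : D.g} (hx : x ∈ rootSpace D.G D.T γ) {b : D.R ⊕ Fin D.d}
    (hb : D.basisWeight b ≠ γ) : D.basis.repr x b = 0 := by
  obtain ⟨t, ht⟩ : ∃ t, charVal (D.basisWeight b) t ≠ charVal γ t := by
    by_contra! h
    exact hb (charVal_injective h)
  have hsum := D.basis.linearCombination_repr x
  rw [Finsupp.linearCombination_apply, Finsupp.sum] at hsum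
  -- Expand `t x t⁻¹ - γ(t) x = 0` in the basis of weight vectors. Linear independence then forces
  -- the coordinate at `b` to vanish, as `t` separates the weight of `b` from `γ`.
  have h : ∑ c ∈ (D.basis.repr x).support,
      (D.basis.repr x c * (charVal (D.basisWeight c) t - charVal γ t)) • D.basis c = 0 := by
    apply Subtype.ext
    have h1 := hx t
    rw [← hsum] at h1
    simp only [AddSubmonoidClass.coe_finsetSum, SetLike.val_smul, Finset.mul_sum,
      Finset.sum_mul, Finset.smul_sum, mul_smul_comm, smul_mul_assoc,
      D.basis_mem_rootSpace _ t] at h1 ⊢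
    rw [← sub_eq_zero, ← Finset.sum_sub_distrib] at h1
    rw [ZeroMemClass.coe_zero, ← h1]
    refine Finset.sum_congr rfl fun c _ => ?_
    rw [mul_sub, sub_smul, mul_smul, smul_comm (charVal γ t), mul_smul]
  by_contra hne
  have := linearIndependent_iff'.mp D.basis.linearIndependent _ _ h b
    (Finsupp.mem_support_iff.mpr hne)
  exact (mul_ne_zero hne (sub_ne_zero.mpr ht)) this

/-- The centralizer of `T` in `𝔤` is `𝔥`. -/
lemma exists_incl_eq {x : D.g} (hx : x ∈ rootSpace D.G D.T 0) : ∃ s, D.incl s = x := by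
  rw [← LieHom.coe_toLinearMap, ← LinearMap.mem_range, ← D.basis.linearCombination_repr x,
    Finsupp.linearCombination_apply]
  refine Submodule.sum_mem _ fun b hb => Submodule.smul_mem _ _ ?_
  rcases b with α | i
  -- Roots are nonzero, so a vector of weight `0` has no coordinate along any `e_α`.
  · exact absurd (D.repr_eq_zero hx (b := Sum.inl α) α.2.1) (Finsupp.mem_support_iff.mp hb)
  · exact ⟨D.hb i, (D.basis_inr i).symm⟩

variable {D} in
/-- Algebra homomorphisms on `U_χ` that agree on `𝔤` are equal. -/
lemma Uχ_algHom_ext {S : Type*} [Ring S] [Algebra K S] {f g : D.Uχ →ₐ[K] S}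
    (h : ∀ x, f (D.gToU x) = g (D.gToU x)) : f = g := by
  apply RingQuot.ringQuot_ext'
  apply UniversalEnvelopingAlgebra.hom_ext
  ext x
  exact h x

/-- `U_χ` is generated by `𝔤`. -/
lemma adjoin_range_gToU : Algebra.adjoin K (Set.range D.gToU) = ⊤ := by
  have h : Set.range D.gToU = RingQuot.mkAlgHom K D.URel ''
      Set.range (UniversalEnvelopingAlgebra.ι K : D.g → UniversalEnvelopingAlgebra K D.g) := by
    rw [← Set.range_comp]; rfl
  rw [h, ← AlgHom.map_adjoin, adjoin_range_ι, Algebra.map_top, AlgHom.range_eq_top]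
  exact RingQuot.mkAlgHom_surjective K D.URel

/-! ### The linear form used to twist -/

variable {A : Type v} [CommRing A] [Algebra K A]

/-- A linear map `𝔤 → A` that vanishes on the `e_α` and on all brackets. -/
structure IsTwist (φ : D.g →ₗ[K] A) : Prop where
  root : ∀ α, φ (D.e α) = 0
  lie : ∀ x y : D.g, φ ⁅x, y⁆ = 0

variable {D} in
lemma IsTwist.neg {φ : D.g →ₗ[K] A} (h : D.IsTwist φ) : D.IsTwist (-φ) :=
  ⟨fun α => by simp [h.root], fun x y => by simp [h.lie]⟩

/-- The linear map `𝔤 → A` that vanishes on the `e_α` and is `π` on `𝔥`. -/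
def twist (π : D.U0 →ₐ[K] A) : D.g →ₗ[K] A :=
  D.basis.constr K (Sum.elim 0 fun i => π (UniversalEnvelopingAlgebra.ι K (D.hb i)))

lemma twist_e (π : D.U0 →ₐ[K] A) (α : D.R) : D.twist π (D.e α) = 0 := by
  rw [← basis_inl, twist, Module.Basis.constr_basis]
  rfl

lemma twist_incl (π : D.U0 →ₐ[K] A) (s : D.h) :
    D.twist π (D.incl s) = π (UniversalEnvelopingAlgebra.ι K s) := by
  have h : (D.twist π).comp (D.incl : D.h →ₗ[K] D.g) =
      π.toLinearMap.comp (UniversalEnvelopingAlgebra.ι K : D.h →ₗ⁅K⁆ D.U0).toLinearMap := by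
    apply D.hb.ext
    intro i
    change D.twist π (D.incl (D.hb i)) = π (UniversalEnvelopingAlgebra.ι K (D.hb i))
    rw [← basis_inr, twist, Module.Basis.constr_basis]
    rfl
  exact LinearMap.congr_fun h s

/-- A vector of nonzero weight has no coordinate along the `h_i`, and the form is zero on the `e_α`.
-/
lemma twist_eq_zero (π : D.U0 →ₐ[K] A) {γ : D.X} (hγ : γ ≠ 0) {x : D.g}
    (hx : x ∈ rootSpace D.G D.T γ) : D.twist π x = 0 := by
  rw [twist, Module.Basis.constr_apply, Finsupp.sum]
  refine Finset.sum_eq_zero fun b _ => ?_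
  rcases b with α | i
  · simp
  · rw [D.repr_eq_zero hx (b := Sum.inr i) hγ.symm, zero_smul]

/-- The only place where the vanishing of `π` on the `h_α` enters. By bilinearity it is enough to
bracket basis vectors, sorted by whether their weights cancel. -/
lemma isTwist_twist (π : D.U0 →ₐ[K] A)
    (hπ : ∀ α β : D.R, (β : D.X) = -(α : D.X) → ∀ s : D.h, D.incl s = ⁅D.e α, D.e β⁆ →
      π (UniversalEnvelopingAlgebra.ι K s) = 0) : D.IsTwist (D.twist π) := by
  refine ⟨D.twist_e π, ?_⟩
  have hbasis : ∀ b c, D.twist π ⁅D.basis b, D.basis c⁆ = 0 := by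
    intro b c
    have hmem := lie_mem_rootSpace (D.basis_mem_rootSpace b) (D.basis_mem_rootSpace c)
    by_cases h0 : D.basisWeight b + D.basisWeight c = 0
    · rcases b with α | i <;> rcases c with β | j
      · rw [h0] at hmem
        obtain ⟨s, hs⟩ := D.exists_incl_eq hmem
        rw [← hs, twist_incl]
        refine hπ α β (neg_eq_of_add_eq_zero_right h0).symm s ?_
        rw [hs, basis_inl, basis_inl]
      · exact absurd ((add_zero _).symm.trans h0) α.2.1
      · exact absurd ((zero_add _).symm.trans h0) β.2.1
      -- Since `A` is commutative, `π` kills the commutator of two elements of `𝔥`.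
      · rw [basis_inr, basis_inr, ← LieHom.map_lie, twist_incl, LieHom.map_lie, Ring.lie_def,
          map_sub, map_mul, map_mul, mul_comm, sub_self]
    · exact D.twist_eq_zero π h0 hmem
  intro x y
  have h : ((LieModule.toEnd K D.g D.g : D.g →ₗ[K] Module.End K D.g).compr₂ (D.twist π)) = 0 :=
    D.basis.ext fun b => D.basis.ext fun c => hbasis b c
  exact LinearMap.congr_fun₂ h x y

/-! ### Twisted actions of `U_χ` -/

variable {D} {M : Type w} [AddCommGroup M] [Module K M] [Module A M] [IsScalarTower K A M]

/-- The Lie algebra homomorphism `x ↦ ρ(x) + φ(x)`. -/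
def twistLie {φ : D.g →ₗ[K] A} (hφ : D.IsTwist φ) (ρ : D.Uχ →ₐ[K] Module.End A M) :
    D.g →ₗ⁅K⁆ Module.End A M where
  toFun x := ρ (D.gToU x) + algebraMap A (Module.End A M) (φ x)
  map_add' x y := by
    simp only [gToU, map_add]; abel
  map_smul' c x := by
    simp only [gToU, map_smul, RingHom.id_apply, smul_add, Algebra.smul_def c (φ x), map_mul]
    congr 1
    ext m
    simp [smul_comm (φ x) c m]
  map_lie' := by
    intro x y
    -- Scalars from `A` are central in `End_A(M)`, so they drop out of commutators. Compatibility
    -- with the bracket then amounts to `φ` killing brackets.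
    have hcomm : ∀ (a b : Module.End A M) (s t : A),
        ⁅a + algebraMap A (Module.End A M) s, b + algebraMap A (Module.End A M) t⁆ = ⁅a, b⁆ := by
      intro a b s t
      simp only [Ring.lie_def, add_mul, mul_add, Algebra.commutes s b, Algebra.commutes t a,
        Algebra.commutes t (algebraMap A (Module.End A M) s)]
      abel
    rw [hφ.lie, map_zero, add_zero, hcomm]
    simp only [gToU, LieHom.map_lie, Ring.lie_def, map_sub, map_mul]

/-- The action of `U_χ` with `x ∈ 𝔤` acting as `ρ(x) + φ(x)`. -/
def twistHom {φ : D.g →ₗ[K] A} (hφ : D.IsTwist φ) (ρ : D.Uχ →ₐ[K] Module.End A M) :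
    D.Uχ →ₐ[K] Module.End A M :=
  RingQuot.liftAlgHom K ⟨UniversalEnvelopingAlgebra.lift K (twistLie hφ ρ), by
    rintro _ _ ⟨α⟩
    rw [map_pow, UniversalEnvelopingAlgebra.lift_ι_apply, AlgHom.commutes]
    change (ρ (D.gToU (D.e α)) + algebraMap A (Module.End A M) (φ (D.e α))) ^ p = _
    -- As `φ(e_α) = 0`, the defining relation is the one already satisfied by `ρ`.
    rw [hφ.root, map_zero, add_zero, ← map_pow, gToU, ← map_pow,
      RingQuot.mkAlgHom_rel K (URel.of α), AlgHom.commutes, AlgHom.commutes]⟩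

lemma twistHom_gToU {φ : D.g →ₗ[K] A} (hφ : D.IsTwist φ) (ρ : D.Uχ →ₐ[K] Module.End A M)
    (x : D.g) : twistHom hφ ρ (D.gToU x) = ρ (D.gToU x) + algebraMap A (Module.End A M) (φ x) := by
  rw [twistHom, gToU, RingQuot.liftAlgHom_mkAlgHom_apply, UniversalEnvelopingAlgebra.lift_ι_apply]
  rfl

lemma twistHom_e {φ : D.g →ₗ[K] A} (hφ : D.IsTwist φ) (ρ : D.Uχ →ₐ[K] Module.End A M)
    (α : D.R) : twistHom hφ ρ (D.gToU (D.e α)) = ρ (D.gToU (D.e α)) := by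
  rw [twistHom_gToU, hφ.root, map_zero, add_zero]

lemma twistHom_neg {φ : D.g →ₗ[K] A} (hφ : D.IsTwist φ) (ρ : D.Uχ →ₐ[K] Module.End A M) :
    twistHom hφ (twistHom hφ.neg ρ) = ρ :=
  Uχ_algHom_ext fun x => by simp [twistHom_gToU]

/-- An `A`-linear map commutes with the added scalars `φ(x)`, so compatibility holds on the
generators `x ∈ 𝔤` and spreads to all of `U_χ`. -/
lemma map_twistHom {N : Type w} [AddCommGroup N] [Module K N] [Module A N] [IsScalarTower K A N]
    {φ : D.g →ₗ[K] A} (hφ : D.IsTwist φ) {ρ : D.Uχ →ₐ[K] Module.End A M}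
    {ρ' : D.Uχ →ₐ[K] Module.End A N} {f : M →ₗ[A] N} (hf : ∀ a m, f (ρ a m) = ρ' a (f m))
    (a : D.Uχ) (m : M) : f (twistHom hφ ρ a m) = twistHom hφ ρ' a (f m) := by
  have ha : a ∈ Algebra.adjoin K (Set.range D.gToU) := by
    rw [adjoin_range_gToU]; trivial
  induction ha using Algebra.adjoin_induction generalizing m with
  | mem a ha =>
    obtain ⟨x, rfl⟩ := ha
    simp [twistHom_gToU, hf]
  | algebraMap c =>
    simp only [AlgHom.commutes, Module.algebraMap_end_apply]
    -- The map is only known to be `A`-linear, so scalars from `K` are moved into `A`.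
    rw [← algebraMap_smul A c m, ← algebraMap_smul A c (f m), map_smul]
  | add a b _ _ ha hb => simp [ha, hb]
  | mul a b _ _ ha hb => simp [ha, hb]

lemma U0toU_ι (s : D.h) : D.U0toU (UniversalEnvelopingAlgebra.ι K s) = D.gToU (D.incl s) := by
  simp [U0toU, gToU]

lemma shift_ι (μ : D.X) (s : D.h) : D.shift μ (UniversalEnvelopingAlgebra.ι K s) =
    UniversalEnvelopingAlgebra.ι K s + algebraMap K D.U0 (dchar μ s) := by
  rw [shift, UniversalEnvelopingAlgebra.lift_ι_apply]
  rfl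

end LeviDatum

/-! ### The twist functor and its inverse -/

variable {K : Type u} [Field K] {p : ℕ} {D : LeviDatum K p} {A : Type v} [CommRing A] [Algebra K A]

/-- On `M_lam^{dμ}` the old action of `h ∈ 𝔥` is by `π(h) + dμ(h)`, and adding `φ(h)` turns it into
`π'(h) + dμ(h)`. The action of the root vectors does not change. -/
lemma IsAction.twist {π π' : D.U0 →ₐ[K] A} {M : GrMod.{u, v, w} D A}
    {ρ : D.Uχ →ₐ[K] Module.End A M.carrier} (h : IsAction π M ρ) {φ : D.g →ₗ[K] A}
    (hφ : D.IsTwist φ) (hπ : ∀ s, π' (UniversalEnvelopingAlgebra.ι K s) =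
      π (UniversalEnvelopingAlgebra.ι K s) + φ (D.incl s)) :
    IsAction π' M (LeviDatum.twistHom hφ ρ) where
  graded := by
    -- The twist alters only generators from `𝔥`. These have degree `0`, and the added scalar
    -- preserves each `M_lam` because it is an `A`-submodule.
    have hgen : ∀ (b : D.R ⊕ D.h) lam, ∀ m ∈ M.gr lam,
        LeviDatum.twistHom hφ ρ (D.gen b) m ∈ M.gr (D.genDeg b + lam) := by
      intro b lam m hm
      have hρ := h.graded (D.genDeg b) lam (D.gen b)
        (Submodule.subset_span ⟨[b], by simp, by simp⟩) m hm
      rcases b with α | s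
      · simpa only [LeviDatum.gen, Sum.elim_inl, LeviDatum.twistHom_e] using hρ
      · simp only [LeviDatum.gen, LeviDatum.genDeg, Sum.elim_inr, LeviDatum.twistHom_gToU,
          LinearMap.add_apply, Module.algebraMap_end_apply, zero_add] at hρ ⊢
        exact add_mem hρ (Submodule.smul_mem _ _ hm)
    intro σ lam a ha m hm
    induction ha using Submodule.span_induction with
    | mem a ha =>
      obtain ⟨l, rfl, rfl⟩ := ha
      induction l with
      | nil => simpa using hm
      | cons b l ih =>
        simpa [add_assoc] using hgen b _ _ ih
    | zero => simp
    | add a b _ _ ha hb => simpa using add_mem ha hb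
    | smul c a _ ha =>
      rw [map_smul, LinearMap.smul_apply, ← algebraMap_smul A c]
      exact Submodule.smul_mem _ _ ha
  weight := by
    intro lam μ hμ s m hm
    have hs : s ∈ Algebra.adjoin K (Set.range (UniversalEnvelopingAlgebra.ι K)) := by
      rw [adjoin_range_ι]; trivial
    induction hs using Algebra.adjoin_induction generalizing m with
    | mem s hs =>
      obtain ⟨s, rfl⟩ := hs
      have hρ := h.weight lam μ hμ (UniversalEnvelopingAlgebra.ι K s) m hm
      rw [LeviDatum.U0toU_ι, LeviDatum.shift_ι, map_add] at *
      rw [LeviDatum.twistHom_gToU, LinearMap.add_apply, hρ, hπ, AlgHom.commutes, AlgHom.commutes,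
        Module.algebraMap_end_apply, ← add_smul, add_right_comm]
    | algebraMap c => simp
    | add a b _ _ ha hb => simp [ha m hm, hb m hm, add_smul]
    | mul a b _ _ ha hb =>
      -- The factor `b` acts by a scalar from `A`, which passes through the `A`-linear action of
      -- `a`. The order of the two scalars is immaterial in `A`.
      rw [map_mul, map_mul, map_mul, map_mul, Module.End.mul_apply, hb m hm, map_smul, ha m hm,
        smul_smul, mul_comm]
  root := by
    intro α lam μ hμ m hm
    rw [LeviDatum.twistHom_e]
    exact h.root α lam μ hμ m hm

/-- The functor that adds `φ` to the action of `𝔤`. -/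
def twistFunctor {π π' : D.U0 →ₐ[K] A} {φ : D.g →ₗ[K] A} (hφ : D.IsTwist φ)
    (hπ : ∀ s, π' (UniversalEnvelopingAlgebra.ι K s) =
      π (UniversalEnvelopingAlgebra.ι K s) + φ (D.incl s)) :
    CObj.{u, v, w} D A π ⥤ CObj.{u, v, w} D A π' where
  obj M := ⟨M.base, LeviDatum.twistHom hφ M.ρ, M.isAction.twist hφ hπ⟩
  map f := ⟨f.toHom, LeviDatum.map_twistHom hφ f.map_act⟩

/-- Twisting by `-φ` inverts the construction: it turns a map compatible with the twisted actions
into one compatible with the original ones, and it provides a preimage of every object. -/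
lemma twistFunctor_isEquivalence {π π' : D.U0 →ₐ[K] A} {φ : D.g →ₗ[K] A} (hφ : D.IsTwist φ)
    (hπ : ∀ s, π' (UniversalEnvelopingAlgebra.ι K s) =
      π (UniversalEnvelopingAlgebra.ι K s) + φ (D.incl s)) :
    (twistFunctor.{u, v, w} hφ hπ).IsEquivalence where
  faithful := ⟨fun {M N f g} h => CObj.Hom.ext (by injection h)⟩
  full := ⟨fun {M N} f => by
    refine ⟨⟨f.toHom, fun a m => ?_⟩, rfl⟩
    have h := LeviDatum.map_twistHom hφ.neg f.map_act a m
    have hneg : ∀ L : CObj.{u, v, w} D A π,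
        LeviDatum.twistHom hφ.neg (LeviDatum.twistHom hφ L.ρ) = L.ρ := fun L =>
      LeviDatum.Uχ_algHom_ext fun x => by simp [LeviDatum.twistHom_gToU]
    change f.toHom.toLin (LeviDatum.twistHom hφ.neg (LeviDatum.twistHom hφ M.ρ) a m) =
      LeviDatum.twistHom hφ.neg (LeviDatum.twistHom hφ N.ρ) a (f.toHom.toLin m) at h
    rwa [hneg, hneg] at h⟩
  essSurj := ⟨fun N => by
    refine ⟨⟨N.base, LeviDatum.twistHom hφ.neg N.ρ,
      -- Untwisting and then twisting returns the same object, so the required isomorphism comes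
      -- from an equality.
      N.isAction.twist hφ.neg fun s => by rw [hπ, LinearMap.neg_apply, add_neg_cancel_right]⟩, ⟨eqToIso ?_⟩⟩
    obtain ⟨M, ρ, h⟩ := N
    simp only [twistFunctor, LeviDatum.twistHom_neg]⟩

end ReducedEnveloping

end

theorem mainTheorem8 {K : Type u} [Field K] [IsAlgClosed K] {p : ℕ} [Fact p.Prime]
    [CharP K p] (D : ReducedEnveloping.LeviDatum K p)
    (A : Type v) [CommRing A] [Algebra K A] [IsNoetherianRing A]
    (π : D.U0 →ₐ[K] A)
    (hπ : ∀ α β : D.R, (β : D.X) = -(α : D.X) → ∀ s : D.h, D.incl s = ⁅D.e α, D.e β⁆ →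
      π (UniversalEnvelopingAlgebra.ι K s) = 0) :
    ∃ Θ : ReducedEnveloping.CObj.{u, v, w} D A (ReducedEnveloping.piZero D A) ≌
        ReducedEnveloping.CObj.{u, v, w} D A π,
      Θ.functor ⋙ ReducedEnveloping.forgetAction π =
        ReducedEnveloping.forgetAction (ReducedEnveloping.piZero D A) ∧
      ∀ M : ReducedEnveloping.CObj.{u, v, w} D A (ReducedEnveloping.piZero D A),
        ∃ (ρ : D.Uχ →ₐ[K] Module.End A M.base.carrier)
          (hρ : ReducedEnveloping.IsAction π M.base ρ),
          Θ.functor.obj M = ⟨M.base, ρ, hρ⟩ ∧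
          (∀ α : D.R, ρ (D.gToU (D.e α)) = M.ρ (D.gToU (D.e α))) ∧
          (∀ lam μ, D.Admissible lam μ → ∀ s : D.U0, ∀ m ∈ M.base.wt lam (ReducedEnveloping.dchar μ),
            ρ (D.U0toU s) m = π (D.shift μ s) • m) := by
  have hφ := D.isTwist_twist π hπ
  -- Since `π°` is zero on `𝔥`, the change of structure map from `π°` to `π` is `π` itself, which is
  -- `φ` on `𝔥`.
  have hadd : ∀ s, π (UniversalEnvelopingAlgebra.ι K s) =
      ReducedEnveloping.piZero D A (UniversalEnvelopingAlgebra.ι K s) +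
        D.twist π (D.incl s) := by
    intro s
    simp [D.twist_incl, ReducedEnveloping.piZero]
  have := ReducedEnveloping.twistFunctor_isEquivalence.{u, v, w} hφ hadd
  -- The functor leaves the graded module and the underlying maps untouched, so compatibility with
  -- forgetting the action holds by definition.
  refine ⟨(ReducedEnveloping.twistFunctor hφ hadd).asEquivalence, rfl, fun M => ?_⟩
  have hρ := M.isAction.twist hφ hadd
  exact ⟨_, hρ, rfl, ReducedEnveloping.LeviDatum.twistHom_e hφ M.ρ, hρ.weight⟩
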